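/- **Setting.** There are $n\ge 1$ players and $m\ge 1$ items. A Bayesian instance $\mathcal I$ is given by independent item values $v_{ij}\sim\mathcal D_{ij}$, where each $\mathcal D_{ij}$ is a probability distribution on $[1,H]$, and by a publicly known valuation profile $v=(v_i)_{i\in[n]}$. The profile is *succinct sub-additive*: for every vector $t\in\mathbb R_{\ge 0}^m$ of item values, $v_i(t,\emptyset)=0$, $v_i(t,S)\le v_i(t,S\cup T)\le v_i(t,S)+v_i(t,T)$ for all $S,T\subseteq[m]$, and $v_i(t,\{j\})=t_j$ for every item $j$. Each item is allocated to at most one player and utilities are quasi-linear. $OPT(\mathcal I)$ is the supremum of the expected revenue over all randomized auctions that are Bayesian incentive compatible and interim individually rational for $\mathcal I$. A mechanism $\mathcal M$ does not know the distributions. It first draws a (possibly random) finite set of queries. Each query names a pair $(i,j)$ and is either a value $x\in\mathbb R$, answered by $\Pr_{y\sim\mathcal D_{ij}}[y\ge x]$, or a quantile $q\in[0,1]$, answered by the largest $z$ with $\Pr_{y\sim\mathcal D_{ij}}[y\ge z]\ge q$ (which is $+\infty$ for $q=0$). All queries are sent at once (non-adaptively). Then $\mathcal M$ runs a (possibly randomized)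 direct-revelation auction that depends only on its own randomness and on the answers. $\mathcal M$ is *DSIC* if, on every prior with item values in $[1,H]$, for all true values and all reports of the other players in $[1,H]$, reporting truthfully maximizes a player's expected utility over the randomness of $\mathcal M$ and makes it non-negative. $Rev(\mathcal M(\mathcal I))$ is the expected sum of payments under truthful reports. **Theorem.** For every constant $c>1$ there is a constant $C>0$, depending only on $c$, such that for all $n,m\ge 1$ there is $H_0$ such that for every $H\ge H_0$ the following holds. For every succinct sub-additive valuation profile $v$ and every DSIC mechanism $\mathcal M$ whose expected number of queries is less than $C\,nm\log_c H$ (in particular, every one that always makes fewer than $C\,nm\log_c H$ queries), there is a Bayesian instance $\mathcal I$ with $n$ players, $m$ items, valuation profile $v$ and item values in $[1,H]$ on which $Rev(\mathcal M(\mathcal I))$ is well defined (the payments are integrable) and $$Rev(\mathcal M(\mathcal I))<\frac{OPT(\mathcal I)}{c}.$$ Thus $\Omega\!\left(\frac{nm\log H}{\log c}\right)$ queries are necessary for a $c$-approximation of the optimal revenue. -/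

import Mathlib

open MeasureTheory

namespace BayesianQuery

/-- The set `T^m` of item-value vectors of one player when every item value lies in `[1, H]`. -/
def Types (m : ℕ) (H : ℝ) : Set (Fin m → ℝ) := {t | ∀ j, t j ∈ Set.Icc 1 H}

/-- A valuation function takes the vector of item values of a player and a set of items. -/
abbrev Valuation (m : ℕ) := (Fin m → ℝ) → Finset (Fin m) → ℝ

/-- Succinct sub-additive valuation functions: for every vector of (non-negative) item values the
set function is normalized, monotone and sub-additive (hence non-negative), and the value of the
singleton `{j}` is the `j`-th item value. -/
structure IsSuccinctSubadditive {m : ℕ} (v : Valuation m) : Prop where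
  empty : ∀ t, (∀ j, 0 ≤ t j) → v t ∅ = 0
  mono : ∀ t, (∀ j, 0 ≤ t j) → ∀ S T : Finset (Fin m), v t S ≤ v t (S ∪ T)
  subadditive : ∀ t, (∀ j, 0 ≤ t j) → ∀ S T : Finset (Fin m), v t (S ∪ T) ≤ v t S + v t T
  singleton : ∀ t, (∀ j, 0 ≤ t j) → ∀ j, v t {j} = t j

/-- The prior of a Bayesian auction instance with `n` players and `m` items: item values are
independent, the value of player `i` for item `j` has law `law i j`, a law on `[1, H]`. -/
structure Prior (n m : ℕ) (H : ℝ) where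
  law : Fin n → Fin m → ProbabilityMeasure ℝ
  bounded : ∀ i j, ∀ᵐ x ∂(law i j : Measure ℝ), x ∈ Set.Icc 1 H

/-- The joint law of the profile of item values (the product of all `law i j`). -/
noncomputable def Prior.joint {n m : ℕ} {H : ℝ} (D : Prior n m H) :
    Measure (Fin n → Fin m → ℝ) :=
  Measure.pi fun i => Measure.pi fun j => (D.law i j : Measure ℝ)

/-- A (deterministic) allocation: every item goes to at most one player. -/
abbrev Allocation (n m : ℕ) := Fin m → Option (Fin n)

/-- The set of items that player `i` receives. -/
def Allocation.bundle {n m : ℕ} (a : Allocation n m) (i : Fin n) : Finset (Fin m) :=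
  Finset.univ.filter fun j => a j = some i

/-- A randomized direct-revelation auction: for every profile of reported item values, a lottery
over allocations and the expected payment of each player (payments may be negative). -/
structure Auction (n m : ℕ) where
  prob : (Fin n → Fin m → ℝ) → Allocation n m → ℝ
  prob_nonneg : ∀ b a, 0 ≤ prob b a
  prob_sum : ∀ b, ∑ a, prob b a = 1
  pay : (Fin n → Fin m → ℝ) → Fin n → ℝ

namespace Auction

variable {n m : ℕ} {H : ℝ}

/-- Expected utility of player `i` with valuation function `v i` and true item values `t` when the
reported profile is `b`. -/
noncomputable def utility (A : Auction n m) (v : Fin n → Valuation m) (i : Fin n)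
    (t : Fin m → ℝ) (b : Fin n → Fin m → ℝ) : ℝ :=
  ∑ a, A.prob b a * v i t (Allocation.bundle a i) - A.pay b i

/-- Dominant-strategy incentive compatibility, with individual rationality: whatever the reports,
truth-telling is optimal and yields non-negative expected utility (over the auction's coins). -/
structure IsDSIC (A : Auction n m) (v : Fin n → Valuation m) (H : ℝ) : Prop where
  truthful : ∀ i, ∀ t ∈ Types m H, ∀ b : Fin n → Fin m → ℝ, (∀ k, b k ∈ Types m H) →
    A.utility v i t b ≤ A.utility v i t (Function.update b i t)
  rational : ∀ i, ∀ t ∈ Types m H, ∀ b : Fin n → Fin m → ℝ, (∀ k, b k ∈ Types m H) →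
    0 ≤ A.utility v i t (Function.update b i t)

/-- Bayesian incentive compatibility, with interim individual rationality: if the others report
truthfully (their values being drawn from the prior), truth-telling is optimal and yields
non-negative expected utility. -/
structure IsBIC (A : Auction n m) (v : Fin n → Valuation m) (D : Prior n m H) : Prop where
  measurable_prob : ∀ a, Measurable fun b => A.prob b a
  measurable_pay : ∀ i, Measurable fun b => A.pay b i
  integrable_pay : ∀ i, Integrable (fun b => A.pay b i) D.joint
  integrable_interim : ∀ i, ∀ r ∈ Types m H,
    Integrable (fun b => A.pay (Function.update b i r) i) D.joint
  truthful : ∀ i, ∀ t ∈ Types m H, ∀ r ∈ Types m H,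
    ∫ b, A.utility v i t (Function.update b i r) ∂D.joint
      ≤ ∫ b, A.utility v i t (Function.update b i t) ∂D.joint
  rational : ∀ i, ∀ t ∈ Types m H,
    0 ≤ ∫ b, A.utility v i t (Function.update b i t) ∂D.joint

/-- Expected revenue when all players report truthfully. -/
noncomputable def revenue (A : Auction n m) (D : Prior n m H) : ℝ :=
  ∫ b, ∑ i, A.pay b i ∂D.joint

end Auction

/-- The optimal revenue of a BIC auction for the given prior and valuation functions. -/
noncomputable def OPT {n m : ℕ} {H : ℝ} (v : Fin n → Valuation m) (D : Prior n m H) : EReal :=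
  ⨆ (A : Auction n m) (_ : A.IsBIC v D), (A.revenue D : EReal)

/-- A query names a player, an item, and either a value (`Sum.inl`) or a quantile (`Sum.inr`). -/
abbrev Query (n m : ℕ) := Fin n × Fin m × (ℝ ⊕ unitInterval)

/-- The oracle. The value query `x` is answered by the quantile `Pr[X ≥ x]`; the quantile query
`q` is answered by the largest `z` such that `Pr[X ≥ z] ≥ q`, which is `+∞` for `q = 0`. -/
noncomputable def oracle (μ : Measure ℝ) : ℝ ⊕ unitInterval → EReal
  | Sum.inl x => (μ.real (Set.Ici x) : EReal)
  | Sum.inr q => sSup ((fun z : ℝ => (z : EReal)) '' {z : ℝ | (q : ℝ) ≤ μ.real (Set.Ici z)})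

/-- The oracle's answer to a query when the prior is `D`. -/
noncomputable def Prior.answer {n m : ℕ} {H : ℝ} (D : Prior n m H) (q : Query n m) : EReal :=
  oracle (D.law q.1 q.2.1 : Measure ℝ) q.2.2

/-- A randomized Bayesian mechanism with non-adaptive queries, for item values in `[1, H]`. It
draws a seed `ω` with law `P`, sends the finitely many queries `queries ω` at once, and then runs
an auction that depends on the seed and on the answers to these queries only. -/
structure QueryMechanism (Ω : Type*) [MeasurableSpace Ω] (P : Measure Ω) (n m : ℕ) (H : ℝ) where
  queries : Ω → Finset (Query n m)
  /-- `queries` is a random finite set: the number of queries in a measurable set is measurable. -/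
  measurable_count : ∀ B : Set (Query n m), MeasurableSet B →
    Measurable fun ω => (((queries ω : Set (Query n m)) ∩ B).ncard)
  auction : (ω : Ω) → ((q : Query n m) → q ∈ queries ω → EReal) → Auction n m
  integrable_prob : ∀ (D : Prior n m H) b a,
    Integrable (fun ω => (auction ω fun q _ => D.answer q).prob b a) P
  integrable_pay : ∀ (D : Prior n m H) b i,
    Integrable (fun ω => (auction ω fun q _ => D.answer q).pay b i) P

namespace QueryMechanism

variable {Ω : Type*} [MeasurableSpace Ω] {P : Measure Ω} {n m : ℕ} {H : ℝ}

/-- The auction that results from the mechanism on the prior `D`, averaged over the seed. -/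
noncomputable def run [IsProbabilityMeasure P] (M : QueryMechanism Ω P n m H) (D : Prior n m H) :
    Auction n m where
  prob b a := ∫ ω, (M.auction ω fun q _ => D.answer q).prob b a ∂P
  prob_nonneg b a := integral_nonneg fun ω => (M.auction ω _).prob_nonneg b a
  prob_sum b := by
    rw [← integral_finsetSum _ fun a _ => M.integrable_prob D b a]
    simp [Auction.prob_sum]
  pay b i := ∫ ω, (M.auction ω fun q _ => D.answer q).pay b i ∂P

/-- The mechanism is DSIC if on every prior the resulting auction is. -/
def IsDSIC [IsProbabilityMeasure P] (M : QueryMechanism Ω P n m H) (v : Fin n → Valuation m) :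
    Prop :=
  ∀ D : Prior n m H, (M.run D).IsDSIC v H

/-- The expected number of queries. -/
noncomputable def queryComplexity (M : QueryMechanism Ω P n m H) : ENNReal :=
  ∫⁻ ω, ((M.queries ω).card : ENNReal) ∂P

end QueryMechanism

end BayesianQuery

/-! Only one value, that of player `i` for item `j`, is random; all others equal `1`. Sub-additivity
then makes player `i` a single-parameter bidder for item `j` up to an additive error `m`, and the
other players pay at most `m` each. Since the ladder starts at `L ≥ 3nm + 1`, these errors are
negligible. The base law is a discrete equal-revenue law on the points `L * r ^ l`, `l ≤ K`: every
rung used as a price earns `L`. A gap law moves the mass of one rung up to the next one, so that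
this higher price earns `L * r`, and `le_OPT` bounds the optimum below by this amount. By
`sum_ladderWeight_mul_le`, an incentive compatible auction earns much more than `L` on a gap law
only if its probability of selling jumps noticeably across that gap. A gap law and the base law give
different answers only to queries in a set attached to that gap, and these sets are disjoint
(`pairwise_disjoint_gapQueries`). Thus the detection probabilities sum to at most the expected
number of queries (`sum_hit_le`). On the base law the jumps telescope, with total at most `2` per
pair `(i, j)`. There are about `n * m * K` gaps, with `K` of order `log H`, so with few queries some
gap is both rarely detected and barely priced (`exists_rare_gap`). The selling probabilities hardly
change between its gap law and the base law (`winProb_run_le`), so the mechanism earns less than `4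
* L`, while the optimum is at least `L * r = 4 * c * L`. -/

namespace BayesianQuery

/-! ### Finitely supported laws. -/

open Finset in
/-- The law that puts mass `w l` on the point `x l`, for `l < N`. -/
noncomputable def discreteLaw {α : Type*} [MeasurableSpace α] (w : ℕ → ℝ) (x : ℕ → α) (N : ℕ) :
    Measure α :=
  ∑ l ∈ range N, ENNReal.ofReal (w l) • Measure.dirac (x l)

section DiscreteLaw

variable {α β : Type*} [MeasurableSpace α] [MeasurableSpace β] {w : ℕ → ℝ} {x : ℕ → α} {N : ℕ}

theorem map_discreteLaw {g : α → β} (hg : Measurable g) :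
    (discreteLaw w x N).map g = discreteLaw w (fun l => g (x l)) N := by
  unfold discreteLaw
  rw [Measure.map_finset_sum hg.aemeasurable]
  refine Finset.sum_congr rfl fun l _ => ?_
  rw [Measure.map_smul, Measure.map_dirac' hg]

/-- Point masses integrate every function, so payments of a DSIC auction, which need not be
measurable in the reports, cause no trouble on the hard priors. -/
theorem integrable_discreteLaw [MeasurableSingletonClass α] (f : α → ℝ) :
    Integrable f (discreteLaw w x N) := by
  unfold discreteLaw
  rw [integrable_finsetSum_measure]
  exact fun l _ => (integrable_dirac (by simp)).smul_measure (by simp)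

theorem integral_discreteLaw [MeasurableSingletonClass α] (hw : ∀ l, 0 ≤ w l) (f : α → ℝ) :
    ∫ a, f a ∂discreteLaw w x N = ∑ l ∈ Finset.range N, w l * f (x l) := by
  unfold discreteLaw
  rw [integral_finsetSum_measure
    fun l _ => (integrable_dirac (by simp)).smul_measure (by simp)]
  refine Finset.sum_congr rfl fun l _ => ?_
  rw [integral_smul_measure, integral_dirac, ENNReal.toReal_ofReal (hw l), smul_eq_mul]

theorem real_discreteLaw [MeasurableSingletonClass α] (hw : ∀ l, 0 ≤ w l) {s : Set α}
    (hs : MeasurableSet s) [DecidablePred (· ∈ s)] :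
    (discreteLaw w x N).real s = ∑ l ∈ Finset.range N, w l * if x l ∈ s then 1 else 0 := by
  classical
  rw [← integral_indicator_one hs, integral_discreteLaw hw]
  simp [Set.indicator_apply]

theorem isProbabilityMeasure_discreteLaw (hw : ∀ l, 0 ≤ w l)
    (h1 : ∑ l ∈ Finset.range N, w l = 1) : IsProbabilityMeasure (discreteLaw w x N) := by
  constructor
  simp [discreteLaw, Measure.finsetSum_apply, ← ENNReal.ofReal_sum_of_nonneg fun l _ => hw l, h1]

theorem ae_discreteLaw [MeasurableSingletonClass α] {p : α → Prop}
    (h : ∀ l ∈ Finset.range N, p (x l)) : ∀ᵐ a ∂discreteLaw w x N, p a := by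
  rw [ae_iff, discreteLaw, Measure.finsetSum_apply]
  refine Finset.sum_eq_zero fun l hl => ?_
  have : Measure.dirac (x l) {a | ¬ p a} = 0 := by
    simp [Measure.dirac_apply, h l hl]
  simp [this]

end DiscreteLaw

/-! ### The equal-revenue ladder and its gap perturbations. -/

/-- The weights of the discrete equal-revenue law with `Pr[index ≥ l] = r⁻¹ ^ l` for `l ≤ K`. -/
noncomputable def ladderWeight (r : ℝ) (K l : ℕ) : ℝ :=
  if l < K then r⁻¹ ^ l - r⁻¹ ^ (l + 1) else r⁻¹ ^ K

section Ladder

variable {r L : ℝ} {K k : ℕ}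

theorem ladderWeight_nonneg (hr : 1 ≤ r) (l : ℕ) : 0 ≤ ladderWeight r K l := by
  have h0 : 0 ≤ r⁻¹ := by positivity
  unfold ladderWeight
  split_ifs
  · exact sub_nonneg.2 (pow_le_pow_of_le_one h0 (inv_le_one_of_one_le₀ hr) (Nat.le_succ l))
  · positivity

/-- Abel summation: each increment of `p` counts with the tail probability, which is the form in
which the incentive constraints between neighbouring rungs apply. -/
theorem sum_ladderWeight_mul (r : ℝ) (K : ℕ) (p : ℕ → ℝ) :
    ∑ l ∈ Finset.range (K + 1), ladderWeight r K l * p l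
      = p 0 + ∑ l ∈ Finset.range K, r⁻¹ ^ (l + 1) * (p (l + 1) - p l) := by
  have key : ∀ N : ℕ, ∑ l ∈ Finset.range N, (r⁻¹ ^ l - r⁻¹ ^ (l + 1)) * p l + r⁻¹ ^ N * p N
      = p 0 + ∑ l ∈ Finset.range N, r⁻¹ ^ (l + 1) * (p (l + 1) - p l) := by
    intro N
    induction N with
    | zero => simp
    | succ N ih =>
      rw [Finset.sum_range_succ, Finset.sum_range_succ]
      linear_combination ih
  rw [← key, Finset.sum_range_succ]
  congr 1
  · refine Finset.sum_congr rfl fun l hl => ?_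
    rw [ladderWeight, if_pos (Finset.mem_range.1 hl)]
  · simp [ladderWeight]

theorem sum_ladderWeight (r : ℝ) (K : ℕ) :
    ∑ l ∈ Finset.range (K + 1), ladderWeight r K l = 1 := by
  simpa using sum_ladderWeight_mul r K fun _ => 1

theorem sum_ladderWeight_tail {a : ℕ} (ha : a ≤ K) :
    ∑ l ∈ Finset.range (K + 1), ladderWeight r K l * (if a ≤ l then 1 else 0) = r⁻¹ ^ a := by
  rw [sum_ladderWeight_mul]
  rcases a with _ | a
  · simp
  · rw [Finset.sum_eq_single a]
    · simp
    · intro l _ hl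
      have : (a + 1 ≤ l + 1) ↔ (a + 1 ≤ l) := by omega
      simp [this]
    · intro h
      exact absurd (Finset.mem_range.2 (by omega)) h

/-- The points of the discrete equal-revenue law, with the mass of the `k`-th point moved to the
next one. -/
noncomputable def gapPoint (L r : ℝ) (k l : ℕ) : ℝ := if l = k then L * r ^ (k + 1) else L * r ^ l

theorem ladder_mono (hL : 0 ≤ L) (hr : 1 ≤ r) : Monotone fun l : ℕ => L * r ^ l :=
  fun _ _ h => mul_le_mul_of_nonneg_left (pow_le_pow_right₀ hr h) hL

theorem ladder_anti (hr : 1 ≤ r) : Antitone fun l : ℕ => r⁻¹ ^ l :=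
  fun _ _ h => pow_le_pow_of_le_one (by positivity) (inv_le_one_of_one_le₀ hr) h

theorem le_ladder_iff (hL : 0 ≤ L) (hr : 1 ≤ r) {z : ℝ}
    (hz : z ∈ Set.Ioc (L * r ^ k) (L * r ^ (k + 1))) (l : ℕ) : z ≤ L * r ^ l ↔ k + 1 ≤ l := by
  constructor
  · intro h
    by_contra hl
    have := ladder_mono hL hr (show l ≤ k by omega)
    simp only at this
    linarith [hz.1]
  · exact fun h => hz.2.trans (ladder_mono hL hr h)

theorem le_gapPoint_iff (hL : 0 ≤ L) (hr : 1 ≤ r) {z : ℝ}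
    (hz : z ∈ Set.Ioc (L * r ^ k) (L * r ^ (k + 1))) (l : ℕ) : z ≤ gapPoint L r k l ↔ k ≤ l := by
  unfold gapPoint
  split_ifs with h
  · simp [hz.2, h]
  · rw [le_ladder_iff hL hr hz]
    omega

/-- The discrete equal-revenue law. -/
noncomputable def ladderLaw (L r : ℝ) (K : ℕ) : Measure ℝ :=
  discreteLaw (ladderWeight r K) (fun l => L * r ^ l) (K + 1)

/-- The discrete equal-revenue law with a gap at the `k`-th point. -/
noncomputable def gapLaw (L r : ℝ) (K k : ℕ) : Measure ℝ :=
  discreteLaw (ladderWeight r K) (gapPoint L r k) (K + 1)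

theorem ladderLaw_Ici (hL : 0 ≤ L) (hr : 1 ≤ r) (hk : k < K) {z : ℝ}
    (hz : z ∈ Set.Ioc (L * r ^ k) (L * r ^ (k + 1))) :
    (ladderLaw L r K).real (Set.Ici z) = r⁻¹ ^ (k + 1) := by
  classical
  rw [ladderLaw, real_discreteLaw (ladderWeight_nonneg hr) measurableSet_Ici]
  simp_rw [Set.mem_Ici, le_ladder_iff hL hr hz]
  exact sum_ladderWeight_tail hk

theorem gapLaw_Ici (hL : 0 ≤ L) (hr : 1 ≤ r) (hk : k < K) {z : ℝ}
    (hz : z ∈ Set.Ioc (L * r ^ k) (L * r ^ (k + 1))) :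
    (gapLaw L r K k).real (Set.Ici z) = r⁻¹ ^ k := by
  classical
  rw [gapLaw, real_discreteLaw (ladderWeight_nonneg hr) measurableSet_Ici]
  simp_rw [Set.mem_Ici, le_gapPoint_iff hL hr hz]
  exact sum_ladderWeight_tail hk.le

/-- Moving an atom from one rung to the next is visible only to thresholds that lie between the two.
-/
theorem gapLaw_Ici_eq_ladderLaw_Ici (hL : 0 ≤ L) (hr : 1 ≤ r) {z : ℝ}
    (hz : z ∉ Set.Ioc (L * r ^ k) (L * r ^ (k + 1))) :
    (gapLaw L r K k).real (Set.Ici z) = (ladderLaw L r K).real (Set.Ici z) := by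
  classical
  rw [gapLaw, ladderLaw, real_discreteLaw (ladderWeight_nonneg hr) measurableSet_Ici,
    real_discreteLaw (ladderWeight_nonneg hr) measurableSet_Ici]
  refine Finset.sum_congr rfl fun l _ => ?_
  have : z ≤ gapPoint L r k l ↔ z ≤ L * r ^ l := by
    unfold gapPoint
    split_ifs with h
    · subst h
      have := ladder_mono hL hr (Nat.le_succ l)
      simp only [Nat.succ_eq_add_one] at this
      refine ⟨fun h1 => ?_, fun h1 => h1.trans this⟩
      by_contra h2
      exact hz ⟨not_le.1 h2, h1⟩
    · rfl
  simp [this]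

/-- The queries that distinguish `gapLaw L r K k` from `ladderLaw L r K`. -/
def gapQueries (L r : ℝ) (k : ℕ) : Set (ℝ ⊕ unitInterval) :=
  Sum.inl '' Set.Ioc (L * r ^ k) (L * r ^ (k + 1)) ∪
    Sum.inr '' {q | (q : ℝ) ∈ Set.Ioc (r⁻¹ ^ (k + 1)) (r⁻¹ ^ k)}

theorem measurableSet_gapQueries (L r : ℝ) (k : ℕ) : MeasurableSet (gapQueries L r k) :=
  (measurableSet_Ioc.inl_image).union
    (measurableSet_inr_image.2 (measurable_subtype_coe measurableSet_Ioc))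

/-- Intervals `Ioc` between consecutive terms of a monotone sequence are disjoint, so one query can
expose at most one gap. -/
theorem pairwise_disjoint_gapQueries (hL : 0 ≤ L) (hr : 1 ≤ r) {k k' : ℕ} {q : ℝ ⊕ unitInterval}
    (h : q ∈ gapQueries L r k) (h' : q ∈ gapQueries L r k') : k = k' := by
  by_contra hne
  rcases q with x | q
  · have := (ladder_mono hL hr).pairwise_disjoint_on_Ioc_succ hne
    simp only [gapQueries, Set.mem_union, Set.mem_image, Sum.inl.injEq, exists_eq_right,
      reduceCtorEq, and_false, exists_false, or_false] at h h'
    exact Set.disjoint_left.1 this h h'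
  · have := (ladder_anti hr).pairwise_disjoint_on_Ioc_succ hne
    simp only [gapQueries, Set.mem_union, Set.mem_image, Sum.inr.injEq, exists_eq_right,
      reduceCtorEq, and_false, exists_false, false_or, Set.mem_ofPred_eq] at h h'
    exact Set.disjoint_left.1 this h h'

theorem oracle_gapLaw (hL : 0 ≤ L) (hr : 1 ≤ r) (hk : k < K) {q : ℝ ⊕ unitInterval}
    (hq : q ∉ gapQueries L r k) : oracle (gapLaw L r K k) q = oracle (ladderLaw L r K) q := by
  rcases q with x | q
  · have hx : x ∉ Set.Ioc (L * r ^ k) (L * r ^ (k + 1)) := fun h => hq (Or.inl ⟨x, h, rfl⟩)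
    simp only [oracle, gapLaw_Ici_eq_ladderLaw_Ici hL hr hx]
  · have hx : (q : ℝ) ∉ Set.Ioc (r⁻¹ ^ (k + 1)) (r⁻¹ ^ k) := fun h => hq (Or.inr ⟨q, h, rfl⟩)
    simp only [oracle]
    -- The superlevel sets themselves agree, so the suprema need not be computed and `q = 0` is no
    -- special case.
    congr 2
    ext z
    simp only [Set.mem_ofPred_eq]
    by_cases hz : z ∈ Set.Ioc (L * r ^ k) (L * r ^ (k + 1))
    · rw [gapLaw_Ici hL hr hk hz, ladderLaw_Ici hL hr hk hz]
      refine ⟨fun h => ?_, fun h => h.trans (ladder_anti hr (Nat.le_succ k))⟩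
      by_contra h2
      exact hx ⟨not_le.1 h2, h⟩
    · rw [gapLaw_Ici_eq_ladderLaw_Ici hL hr hz]

theorem sum_inv_pow_le (hr : 2 ≤ r) (K : ℕ) : ∑ l ∈ Finset.range K, r⁻¹ ^ (l + 1) ≤ 1 := by
  have h2 : r⁻¹ ≤ 2⁻¹ := inv_anti₀ (by norm_num) hr
  have h0 : 0 ≤ r⁻¹ := by positivity
  suffices ∑ l ∈ Finset.range K, r⁻¹ ^ (l + 1) ≤ 1 - r⁻¹ ^ K by
    have : 0 ≤ r⁻¹ ^ K := by positivity
    linarith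
  induction K with
  | zero => simp
  | succ K ih =>
    rw [Finset.sum_range_succ, pow_succ]
    have : 0 ≤ r⁻¹ ^ K := by positivity
    nlinarith

/-- Revenue of an approximately incentive compatible single-parameter auction on a gap law. -/
theorem sum_ladderWeight_mul_le {e : ℝ} (hL : 0 ≤ L) (hr : 2 ≤ r) (he : 0 ≤ e) (hk : k + 1 < K)
    {p q : ℕ → ℝ} (hq : ∀ l, q l ≤ 1) (h0 : p 0 ≤ gapPoint L r (k + 1) 0 * q 0 + e)
    (hs : ∀ l < K, p (l + 1) ≤ p l + gapPoint L r (k + 1) (l + 1) * (q (l + 1) - q l) + e) :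
    ∑ l ∈ Finset.range (K + 1), ladderWeight r K l * p l
      ≤ L + L * (r - 1) * (q (k + 1) - q k) + 2 * e := by
  have hr0 : 0 < r := by linarith
  -- The tail probability cancels the point `L * r ^ (l + 1)` and leaves the factor `L`. At `l = k`
  -- the point is one rung higher, which leaves `L * r`, hence the surplus `L * (r - 1)`.
  have term : ∀ l < K, r⁻¹ ^ (l + 1) * (p (l + 1) - p l) ≤ L * (q (l + 1) - q l)
      + (if l = k then L * (r - 1) * (q (l + 1) - q l) else 0) + r⁻¹ ^ (l + 1) * e := by
    intro l hl
    have hpos : 0 < r⁻¹ ^ (l + 1) := by positivity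
    have h1 : r⁻¹ ^ (l + 1) * r ^ (l + 1) = 1 := by
      rw [← mul_pow, inv_mul_cancel₀ hr0.ne', one_pow]
    refine (mul_le_mul_of_nonneg_left (show p (l + 1) - p l ≤ _ by linarith [hs l hl]) hpos.le).trans
      (b := r⁻¹ ^ (l + 1) * (gapPoint L r (k + 1) (l + 1) * (q (l + 1) - q l) + e)) ?_
    apply le_of_eq
    unfold gapPoint
    by_cases h : l = k
    · subst h
      simp only [if_true]
      rw [pow_succ r (l + 1)]
      linear_combination (L * r * (q (l + 1) - q l)) * h1
    · have h' : l + 1 ≠ k + 1 := by omega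
      simp only [h, h', if_false]
      linear_combination (L * (q (l + 1) - q l)) * h1
  -- The `L`-terms telescope and, with `h0`, leave `L * q K ≤ L`. The errors are `e` from `h0` and
  -- at most `e` from the geometric series.
  rw [sum_ladderWeight_mul]
  have hsum := Finset.sum_le_sum fun l (hl : l ∈ Finset.range K) => term l (Finset.mem_range.1 hl)
  rw [Finset.sum_add_distrib, Finset.sum_add_distrib, ← Finset.mul_sum, Finset.sum_range_sub,
    Finset.sum_ite_eq' (Finset.range K) k, if_pos (Finset.mem_range.2 (by omega)),
    ← Finset.sum_mul] at hsum
  have hx : gapPoint L r (k + 1) 0 = L := by simp [gapPoint]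
  rw [hx] at h0
  have := mul_le_mul_of_nonneg_left (hq K) hL
  have := mul_le_mul_of_nonneg_right (sum_inv_pow_le hr K) he
  linarith

end Ladder

/-! ### Priors with a single random value. -/

variable {n m : ℕ} {H : ℝ}

/-- The profile in which player `i` has value `x` for item `j` and all other values are `1`. -/
def profile (i : Fin n) (j : Fin m) (x : ℝ) : Fin n → Fin m → ℝ :=
  fun i' j' => if i' = i ∧ j' = j then x else 1

theorem measurable_profile (i : Fin n) (j : Fin m) : Measurable (profile i j) := by
  refine measurable_pi_lambda _ fun i' => measurable_pi_lambda _ fun j' => ?_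
  unfold profile
  split_ifs
  · exact measurable_id
  · exact measurable_const

theorem profile_mem_Types (hH : 1 ≤ H) (i : Fin n) (j : Fin m) {x : ℝ} (hx : x ∈ Set.Icc 1 H)
    (k : Fin n) : profile i j x k ∈ Types m H := by
  intro j'
  unfold profile
  split_ifs
  · exact hx
  · exact ⟨le_rfl, hH⟩

/-- Deviations of player `i` in item `j` stay in the one-parameter family, so DSIC can be used along
it. -/
theorem update_profile (i : Fin n) (j : Fin m) (x y : ℝ) :
    Function.update (profile i j y) i (profile i j x i) = profile i j x := by
  funext i'
  by_cases h : i' = i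
  · subst h
    simp
  · rw [Function.update_of_ne h]
    funext j'
    simp [profile, h]

theorem Prior.joint_map_eval (D : Prior n m H) (i : Fin n) (j : Fin m) :
    D.joint.map (fun b => b i j) = D.law i j := by
  have h1 := (measurePreserving_eval
    (fun i => Measure.pi fun j => (D.law i j : Measure ℝ)) i).map_eq
  have h2 := (measurePreserving_eval (fun j => (D.law i j : Measure ℝ)) j).map_eq
  rw [← h2, ← h1, Measure.map_map (measurable_pi_apply j) (measurable_pi_apply i)]
  rfl

/-- A measure of total mass one as a bundled probability measure. -/
def toProbabilityMeasure (μ : Measure ℝ) [h : IsProbabilityMeasure μ] : ProbabilityMeasure ℝ :=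
  ⟨μ, h⟩

@[simp]
theorem coe_toProbabilityMeasure (μ : Measure ℝ) [IsProbabilityMeasure μ] :
    (toProbabilityMeasure μ : Measure ℝ) = μ := rfl

/-- The prior in which player `i`'s value for item `j` has law `μ` and all other values are `1`. -/
noncomputable def singlePrior (hH : 1 ≤ H) (i : Fin n) (j : Fin m) (μ : Measure ℝ)
    [IsProbabilityMeasure μ] (hμ : ∀ᵐ x ∂μ, x ∈ Set.Icc 1 H) : Prior n m H where
  law i' j' := if i' = i ∧ j' = j then toProbabilityMeasure μ
    else toProbabilityMeasure (Measure.dirac 1)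
  bounded i' j' := by
    by_cases h : i' = i ∧ j' = j
    · rw [if_pos h]
      exact hμ
    · rw [if_neg h]
      exact (ae_dirac_iff measurableSet_Icc).2 ⟨le_rfl, hH⟩

section SinglePrior

variable (hH : 1 ≤ H) (i : Fin n) (j : Fin m) (μ : Measure ℝ) [IsProbabilityMeasure μ]
  (hμ : ∀ᵐ x ∂μ, x ∈ Set.Icc 1 H)

theorem singlePrior_law_self : ((singlePrior hH i j μ hμ).law i j : Measure ℝ) = μ := by
  simp [singlePrior]

/-- Almost surely every other coordinate is `1`, so `b` is recovered from `b i j`, whose law is `μ`.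
-/
theorem joint_singlePrior : (singlePrior hH i j μ hμ).joint = μ.map (profile i j) := by
  set D := singlePrior hH i j μ hμ with hD
  have hae : ∀ᵐ b ∂D.joint, b = profile i j (b i j) := by
    have : ∀ i' j', ∀ᵐ b ∂D.joint, b i' j' = profile i j (b i j) i' j' := by
      intro i' j'
      by_cases h : i' = i ∧ j' = j
      · obtain ⟨rfl, rfl⟩ := h
        simp [profile]
      · have hm : Measurable fun b : Fin n → Fin m → ℝ => b i' j' :=
          (measurable_pi_apply j').comp (measurable_pi_apply i')
        have h1 : ∀ᵐ x ∂(D.joint.map fun b => b i' j'), x = 1 := by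
          rw [D.joint_map_eval]
          simp [hD, singlePrior, h, ae_dirac_eq]
        have h2 := ae_of_ae_map hm.aemeasurable h1
        filter_upwards [h2] with b hb
        simp [profile, h, hb]
    filter_upwards [ae_all_iff.2 fun i' => ae_all_iff.2 (this i')] with b hb
    funext i' j'
    exact hb i' j'
  have hm : Measurable fun b : Fin n → Fin m → ℝ => b i j :=
    (measurable_pi_apply j).comp (measurable_pi_apply i)
  calc D.joint = D.joint.map id := Measure.map_id.symm
    _ = D.joint.map (profile i j ∘ fun b => b i j) := Measure.map_congr hae
    _ = (D.joint.map fun b => b i j).map (profile i j) :=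
      (Measure.map_map (measurable_profile i j) hm).symm
    _ = μ.map (profile i j) := by rw [D.joint_map_eval, singlePrior_law_self]

theorem answer_singlePrior_of_ne (ν : Measure ℝ) [IsProbabilityMeasure ν]
    (hν : ∀ᵐ x ∂ν, x ∈ Set.Icc 1 H) {q : Query n m}
    (h : q.1 = i ∧ q.2.1 = j → oracle μ q.2.2 = oracle ν q.2.2) :
    (singlePrior hH i j μ hμ).answer q = (singlePrior hH i j ν hν).answer q := by
  unfold Prior.answer
  by_cases hq : q.1 = i ∧ q.2.1 = j
  · obtain ⟨h1, h2⟩ := hq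
    rw [h1, h2, singlePrior_law_self, singlePrior_law_self, h ⟨h1, h2⟩]
  · simp [singlePrior, hq]

end SinglePrior

/-! ### Additive bounds for sub-additive valuations. -/

section Valuation

variable {f : Valuation m} (hf : IsSuccinctSubadditive f) {t : Fin m → ℝ} (ht : ∀ j, 0 ≤ t j)
include hf ht

theorem IsSuccinctSubadditive.mono_subset {S T : Finset (Fin m)} (h : S ⊆ T) : f t S ≤ f t T := by
  simpa [Finset.union_eq_right.2 h] using hf.mono t ht S T

theorem IsSuccinctSubadditive.nonneg (S : Finset (Fin m)) : 0 ≤ f t S := by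
  rw [← hf.empty t ht]
  exact hf.mono_subset ht (Finset.empty_subset S)

theorem IsSuccinctSubadditive.ite_le (j : Fin m) (S : Finset (Fin m)) :
    (if j ∈ S then t j else 0) ≤ f t S := by
  split_ifs with h
  · rw [← hf.singleton t ht j]
    exact hf.mono_subset ht (Finset.singleton_subset_iff.2 h)
  · exact hf.nonneg ht S

theorem IsSuccinctSubadditive.le_sum (S : Finset (Fin m)) : f t S ≤ ∑ j ∈ S, t j := by
  induction S using Finset.induction_on with
  | empty => simp [hf.empty t ht]
  | insert a s ha ih =>
    rw [Finset.sum_insert ha, Finset.insert_eq, ← hf.singleton t ht a]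
    exact (hf.subadditive t ht _ _).trans (by gcongr)

/-- With `ite_le` this sandwiches the valuation: up to `m`, only winning item `j` matters. -/
theorem IsSuccinctSubadditive.le_ite_add {j : Fin m} (h1 : ∀ j' ≠ j, t j' ≤ 1)
    (S : Finset (Fin m)) : f t S ≤ (if j ∈ S then t j else 0) + m := by
  have hc : (S.card : ℝ) ≤ m := by
    exact_mod_cast (Finset.card_le_univ S).trans_eq (Fintype.card_fin m)
  calc f t S ≤ ∑ j' ∈ S, t j' := hf.le_sum ht S
    _ ≤ ∑ j' ∈ S, ((if j' = j then t j' else 0) + 1) := by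
      refine Finset.sum_le_sum fun j' _ => ?_
      split_ifs with h
      · linarith
      · linarith [h1 j' h]
    _ = (if j ∈ S then t j else 0) + S.card := by
      rw [Finset.sum_add_distrib, Finset.sum_ite_eq' S j]
      simp
    _ ≤ _ := by gcongr

end Valuation

/-! ### Posted prices as lower bounds for the optimal revenue. -/

open Classical in
/-- Offer item `j` to player `i` at price `p`. -/
noncomputable def postedPrice (i : Fin n) (j : Fin m) (p : ℝ) : Auction n m where
  prob b a := if a = (fun j' => if p ≤ b i j ∧ j' = j then some i else none) then 1 else 0
  prob_nonneg b a := by split_ifs <;> norm_num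
  prob_sum b := by simp
  pay b i' := if i' = i ∧ p ≤ b i j then p else 0

theorem utility_postedPrice {v : Fin n → Valuation m} (hv : ∀ i, IsSuccinctSubadditive (v i))
    (i : Fin n) (j : Fin m) (p : ℝ) (i' : Fin n) {t : Fin m → ℝ} (ht : ∀ j, 0 ≤ t j)
    (b : Fin n → Fin m → ℝ) :
    (postedPrice i j p).utility v i' t b = if i' = i ∧ p ≤ b i j then t j - p else 0 := by
  classical
  have : ∀ c : Allocation n m, ∑ a, (if a = c then (1 : ℝ) else 0) * v i' t (a.bundle i')
      = v i' t (c.bundle i') := by simp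
  unfold Auction.utility postedPrice
  dsimp only
  rw [this]
  by_cases h : i' = i ∧ p ≤ b i j
  · have hb : Allocation.bundle (fun j' : Fin m => if p ≤ b i j ∧ j' = j then some i else none) i'
        = {j} := by
      ext j'
      simp [Allocation.bundle, h.1, h.2]
    rw [hb, (hv i').singleton t ht]
    simp [h]
  · have hb : Allocation.bundle (fun j' : Fin m => if p ≤ b i j ∧ j' = j then some i else none) i'
        = ∅ := by
      ext j'
      by_cases h1 : i' = i
      · have h2 : ¬ p ≤ b i j := fun h2 => h ⟨h1, h2⟩
        simp [Allocation.bundle, h2]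
      · simp [Allocation.bundle, Ne.symm h1]
    rw [hb, (hv i').empty t ht]
    simp [h]

/-- A player's utility depends only on that player's own report, so the interim integrals are over
constants. -/
theorem isBIC_postedPrice {v : Fin n → Valuation m} (hv : ∀ i, IsSuccinctSubadditive (v i))
    (i : Fin n) (j : Fin m) (p : ℝ) (D : Prior n m H) : (postedPrice i j p).IsBIC v D := by
  classical
  have : IsProbabilityMeasure D.joint := by unfold Prior.joint; infer_instance
  have hm : Measurable fun b : Fin n → Fin m → ℝ => b i j :=
    (measurable_pi_apply j).comp (measurable_pi_apply i)
  have hs : MeasurableSet {b : Fin n → Fin m → ℝ | p ≤ b i j} := hm measurableSet_Ici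
  have hpay : ∀ i', Measurable fun b => (postedPrice i j p).pay b i' := by
    intro i'
    exact Measurable.ite ((MeasurableSet.const _).inter hs) measurable_const measurable_const
  have hbdd : ∀ i' (b : Fin n → Fin m → ℝ), ‖(postedPrice i j p).pay b i'‖ ≤ ‖p‖ := by
    intro i' b
    simp only [postedPrice]
    split_ifs <;> simp
  have hpos : ∀ t ∈ Types m H, ∀ j, 0 ≤ t j := fun t ht j => zero_le_one.trans (ht j).1
  have hutil : ∀ i', ∀ t ∈ Types m H, ∀ r b,
      (postedPrice i j p).utility v i' t (Function.update b i' r)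
        = if i' = i ∧ p ≤ r j then t j - p else 0 := by
    intro i' t ht r b
    rw [utility_postedPrice hv i j p i' (hpos t ht)]
    by_cases h : i' = i
    · subst h; simp
    · simp [h]
  refine ⟨fun a => ?_, hpay, fun i' => ?_, fun i' r _ => ?_, fun i' t ht r _ => ?_,
    fun i' t ht => ?_⟩
  · have : (fun b => (postedPrice i j p).prob b a) = fun b => if p ≤ b i j then
        (if a = (fun j' => if j' = j then some i else none) then (1 : ℝ) else 0) else
        (if a = (fun _ => none) then (1 : ℝ) else 0) := by
      funext b
      by_cases h : p ≤ b i j <;> simp [postedPrice, h]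
    rw [this]
    exact Measurable.ite hs measurable_const measurable_const
  · exact Integrable.of_bound (hpay i').aestronglyMeasurable ‖p‖ (ae_of_all _ (hbdd i'))
  · exact Integrable.of_bound ((hpay i').comp
      (measurable_update' .. |>.comp (measurable_id.prodMk measurable_const))).aestronglyMeasurable
      ‖p‖ (ae_of_all _ fun b => hbdd i' _)
  · simp only [hutil i' t ht, integral_const, probReal_univ, one_smul]
    by_cases h : i' = i
    · simp only [h, true_and]
      split_ifs <;> linarith
    · simp [h]
  · simp only [hutil i' t ht, integral_const, probReal_univ, one_smul]
    split_ifs with h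
    · linarith [h.2]
    · exact le_rfl

theorem revenue_postedPrice (i : Fin n) (j : Fin m) (p : ℝ) (D : Prior n m H) :
    (postedPrice i j p).revenue D = p * (D.law i j : Measure ℝ).real (Set.Ici p) := by
  have hm : Measurable fun b : Fin n → Fin m → ℝ => b i j :=
    (measurable_pi_apply j).comp (measurable_pi_apply i)
  have hs : MeasurableSet {b : Fin n → Fin m → ℝ | p ≤ b i j} := hm measurableSet_Ici
  have h : ∀ b : Fin n → Fin m → ℝ, ∑ i', (postedPrice i j p).pay b i'
      = {b : Fin n → Fin m → ℝ | p ≤ b i j}.indicator (fun _ => p) b := by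
    intro b
    simp only [postedPrice, Set.indicator, Set.mem_ofPred_eq, ite_and]
    simp
  unfold Auction.revenue
  simp_rw [h]
  rw [integral_indicator_const _ hs, smul_eq_mul, mul_comm, ← D.joint_map_eval,
    map_measureReal_apply hm measurableSet_Ici]
  rfl

theorem le_OPT {v : Fin n → Valuation m} (hv : ∀ i, IsSuccinctSubadditive (v i))
    (i : Fin n) (j : Fin m) (p : ℝ) (D : Prior n m H) :
    ((p * (D.law i j : Measure ℝ).real (Set.Ici p) : ℝ) : EReal) ≤ OPT v D := by
  rw [← revenue_postedPrice]
  exact le_iSup₂_of_le _ (isBIC_postedPrice hv i j p D) le_rfl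

/-! ### DSIC auctions restricted to one-parameter profiles. -/

namespace Auction

/-- The probability that player `i` receives item `j`. -/
noncomputable def winProb (A : Auction n m) (i : Fin n) (j : Fin m) (b : Fin n → Fin m → ℝ) : ℝ :=
  ∑ a, A.prob b a * if a j = some i then 1 else 0

variable (A : Auction n m) (i : Fin n) (j : Fin m)

theorem winProb_nonneg (b : Fin n → Fin m → ℝ) : 0 ≤ A.winProb i j b :=
  Finset.sum_nonneg fun a _ => mul_nonneg (A.prob_nonneg b a) (by split_ifs <;> norm_num)

theorem winProb_le_one (b : Fin n → Fin m → ℝ) : A.winProb i j b ≤ 1 := by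
  rw [← A.prob_sum b]
  refine Finset.sum_le_sum fun a _ => mul_le_of_le_one_right (A.prob_nonneg b a) ?_
  split_ifs <;> norm_num

theorem expectation_le {g : Allocation n m → ℝ} {y e : ℝ} (b : Fin n → Fin m → ℝ)
    (h : ∀ a, g a ≤ (if a j = some i then y else 0) + e) :
    ∑ a, A.prob b a * g a ≤ y * A.winProb i j b + e := by
  calc ∑ a, A.prob b a * g a
      ≤ ∑ a, (y * (A.prob b a * if a j = some i then 1 else 0) + A.prob b a * e) := by
        refine Finset.sum_le_sum fun a _ => ?_
        refine (mul_le_mul_of_nonneg_left (h a) (A.prob_nonneg b a)).trans_eq ?_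
        split_ifs <;> ring
    _ = _ := by
        rw [Finset.sum_add_distrib, ← Finset.mul_sum, ← Finset.sum_mul, A.prob_sum, one_mul]
        rfl

theorem le_expectation {g : Allocation n m → ℝ} {y : ℝ} (b : Fin n → Fin m → ℝ)
    (h : ∀ a, (if a j = some i then y else 0) ≤ g a) :
    y * A.winProb i j b ≤ ∑ a, A.prob b a * g a := by
  rw [winProb, Finset.mul_sum]
  refine Finset.sum_le_sum fun a _ => ?_
  refine Eq.trans_le ?_ (mul_le_mul_of_nonneg_left (h a) (A.prob_nonneg b a))
  split_ifs <;> ring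

variable {A} {i j} {v : Fin n → Valuation m}

theorem mem_bundle {a : Allocation n m} : j ∈ a.bundle i ↔ a j = some i := by
  simp [Allocation.bundle]

section

variable (hA : A.IsDSIC v H) (hv : ∀ i, IsSuccinctSubadditive (v i)) (hH : 1 ≤ H)
  {y z : ℝ} (hy : y ∈ Set.Icc 1 H) (hz : z ∈ Set.Icc 1 H)
include hv hy

theorem value_profile_le (a : Allocation n m) :
    v i (profile i j y i) (a.bundle i) ≤ (if a j = some i then y else 0) + m := by
  have hy0 : 0 ≤ y := zero_le_one.trans hy.1
  have := (hv i).le_ite_add (t := profile i j y i) (j := j)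
    (fun j' => by unfold profile; split_ifs <;> linarith)
    (fun j' h => by simp [profile, h]) (a.bundle i)
  simpa [mem_bundle, profile] using this

theorem le_value_profile (a : Allocation n m) :
    (if a j = some i then y else 0) ≤ v i (profile i j y i) (a.bundle i) := by
  have hy0 : 0 ≤ y := zero_le_one.trans hy.1
  have := (hv i).ite_le (t := profile i j y i)
    (fun j' => by unfold profile; split_ifs <;> linarith) j (a.bundle i)
  simpa [mem_bundle, profile] using this

include hA hH

theorem pay_le_of_rational : A.pay (profile i j y) i ≤ y * A.winProb i j (profile i j y) + m := by
  have h := hA.rational i _ (profile_mem_Types hH i j hy i) _ (profile_mem_Types hH i j hy)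
  rw [update_profile, utility] at h
  linarith [A.expectation_le i j (profile i j y) (value_profile_le (j := j) hv hy)]

-- True type `y` does not gain by reporting `z`. The value of truth-telling is bounded above with
-- slack `m`, that of the deviation below without slack, so the error is a single `m`.
include hz in
theorem pay_le_of_truthful : A.pay (profile i j y) i ≤ A.pay (profile i j z) i
    + y * (A.winProb i j (profile i j y) - A.winProb i j (profile i j z)) + m := by
  have h := hA.truthful i _ (profile_mem_Types hH i j hy i) _ (profile_mem_Types hH i j hz)
  rw [update_profile, utility, utility] at h
  linarith [A.expectation_le i j (profile i j y) (value_profile_le (j := j) hv hy),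
    A.le_expectation i j (profile i j z) (le_value_profile (j := j) hv hy)]

/-- Individual rationality: all values of player `i'` are `1`, so no bundle is worth more than `m`.
-/
theorem pay_le_of_ne {i' : Fin n} (hi : i' ≠ i) : A.pay (profile i j y) i' ≤ m := by
  have h := hA.rational i' _ (profile_mem_Types hH i j hy i') _ (profile_mem_Types hH i j hy)
  rw [Function.update_eq_self, utility] at h
  have hval : ∀ S, v i' (profile i j y i') S ≤ m := by
    intro S
    have hc : (S.card : ℝ) ≤ m := by
      exact_mod_cast (Finset.card_le_univ S).trans_eq (Fintype.card_fin m)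
    refine ((hv i').le_sum (fun j' => ?_) S).trans ?_
    · simp [profile, hi]
    · simpa [profile, hi] using hc
  have : ∑ a, A.prob (profile i j y) a * v i' (profile i j y i') (a.bundle i') ≤ m := by
    calc _ ≤ ∑ a, A.prob (profile i j y) a * (m : ℝ) :=
          Finset.sum_le_sum fun a _ => mul_le_mul_of_nonneg_left (hval _) (A.prob_nonneg _ a)
      _ = m := by rw [← Finset.sum_mul, A.prob_sum, one_mul]
  linarith

theorem sum_pay_le :
    ∑ i', A.pay (profile i j y) i' ≤ A.pay (profile i j y) i + n * m := by
  rw [← Finset.add_sum_erase _ _ (Finset.mem_univ i)]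
  gcongr
  calc ∑ i' ∈ Finset.univ.erase i, A.pay (profile i j y) i'
      ≤ ∑ i' ∈ Finset.univ.erase i, (m : ℝ) := Finset.sum_le_sum fun i' hi' =>
        pay_le_of_ne hA hv hH hy (Finset.ne_of_mem_erase hi')
    _ ≤ ∑ i' : Fin n, (m : ℝ) := Finset.sum_le_sum_of_subset_of_nonneg (Finset.erase_subset _ _)
        fun _ _ _ => by positivity
    _ = n * m := by simp

end

theorem revenue_singlePrior_discreteLaw {w x : ℕ → ℝ} {N : ℕ}
    [IsProbabilityMeasure (discreteLaw w x N)] (hH : 1 ≤ H)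
    (hμ : ∀ᵐ x ∂(discreteLaw w x N), x ∈ Set.Icc 1 H) (hw : ∀ l, 0 ≤ w l) (A : Auction n m) :
    Integrable (fun b => ∑ i, A.pay b i) (singlePrior hH i j (discreteLaw w x N) hμ).joint ∧
    A.revenue (singlePrior hH i j (discreteLaw w x N) hμ)
      = ∑ l ∈ Finset.range N, w l * ∑ i', A.pay (profile i j (x l)) i' := by
  unfold revenue
  rw [joint_singlePrior, map_discreteLaw (measurable_profile i j)]
  exact ⟨integrable_discreteLaw _, integral_discreteLaw hw _⟩

end Auction

/-! ### Detection of a perturbation by random queries. -/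

namespace QueryMechanism

variable {Ω : Type*} [MeasurableSpace Ω] {P : Measure Ω} (M : QueryMechanism Ω P n m H)

/-- The event that some query lies in `B`. -/
def hit (B : Set (Query n m)) : Set Ω := {ω | ((M.queries ω : Set (Query n m)) ∩ B).ncard ≠ 0}

variable {M}

theorem measurableSet_hit {B : Set (Query n m)} (hB : MeasurableSet B) :
    MeasurableSet (M.hit B) :=
  M.measurable_count B hB (MeasurableSet.of_discrete (s := {0}ᶜ))

theorem notMem_of_notMem_hit {B : Set (Query n m)} {ω : Ω} (h : ω ∉ M.hit B) {q : Query n m}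
    (hq : q ∈ M.queries ω) : q ∉ B := by
  intro hqB
  have h0 : ((M.queries ω : Set (Query n m)) ∩ B).ncard = 0 := by simpa [hit] using h
  rw [Set.ncard_eq_zero ((M.queries ω).finite_toSet.inter_of_left B)] at h0
  exact Set.eq_empty_iff_forall_notMem.1 h0 q ⟨hq, hqB⟩

/-- A hit indicator is at most the number of queries in `B x`, and over disjoint sets these numbers
add up to at most the total. -/
theorem sum_hit_le {ι : Type*} (s : Finset ι) (B : ι → Set (Query n m))
    (hB : ∀ x, MeasurableSet (B x)) (hd : ∀ x y q, q ∈ B x → q ∈ B y → x = y) :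
    ∑ x ∈ s, P (M.hit (B x)) ≤ M.queryComplexity := by
  classical
  have hcount : ∀ x, Measurable fun ω =>
      ((((M.queries ω : Set (Query n m)) ∩ B x).ncard : ℕ) : ENNReal) := fun x =>
    (Measurable.of_discrete (f := fun k : ℕ => (k : ENNReal))).comp (M.measurable_count _ (hB x))
  calc ∑ x ∈ s, P (M.hit (B x))
      = ∑ x ∈ s, ∫⁻ ω, (M.hit (B x)).indicator 1 ω ∂P := by
        simp_rw [lintegral_indicator_one (measurableSet_hit (hB _))]
    _ ≤ ∑ x ∈ s, ∫⁻ ω, ((((M.queries ω : Set (Query n m)) ∩ B x).ncard : ℕ) : ENNReal) ∂P := by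
        refine Finset.sum_le_sum fun x _ => lintegral_mono fun ω => ?_
        by_cases h : ω ∈ M.hit (B x)
        · rw [Set.indicator_of_mem h, Pi.one_apply]
          exact Nat.one_le_cast.2 (Nat.one_le_iff_ne_zero.2 h)
        · rw [Set.indicator_of_notMem h]
          exact zero_le
    _ = ∫⁻ ω, ∑ x ∈ s, ((((M.queries ω : Set (Query n m)) ∩ B x).ncard : ℕ) : ENNReal) ∂P :=
        (lintegral_finsetSum s fun x _ => hcount x).symm
    _ ≤ M.queryComplexity := by
        refine lintegral_mono fun ω => ?_
        have h1 : ∀ x, ((M.queries ω : Set (Query n m)) ∩ B x).ncard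
            = ((M.queries ω).filter (· ∈ B x)).card := by
          intro x
          rw [← Set.ncard_coe_finset, Finset.coe_filter]
          rfl
        simp_rw [h1]
        rw [← Nat.cast_sum, ← Finset.card_biUnion]
        · exact_mod_cast Finset.card_le_card
            (Finset.biUnion_subset.2 fun x _ => Finset.filter_subset _ _)
        · intro x _ y _ hxy
          refine Finset.disjoint_left.2 fun q hx hy => hxy ?_
          exact hd x y q (Finset.mem_filter.1 hx).2 (Finset.mem_filter.1 hy).2

theorem sum_real_hit_le [IsProbabilityMeasure P] {ι : Type*} (s : Finset ι)
    (B : ι → Set (Query n m)) (hB : ∀ x, MeasurableSet (B x))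
    (hd : ∀ x y q, q ∈ B x → q ∈ B y → x = y) (hM : M.queryComplexity ≠ ⊤) :
    ∑ x ∈ s, P.real (M.hit (B x)) ≤ M.queryComplexity.toReal := by
  simp only [Measure.real]
  rw [← ENNReal.toReal_sum fun x _ => measure_ne_top _ _]
  exact ENNReal.toReal_mono hM (sum_hit_le s B hB hd)

/-- Couple the two runs by the seed: off the hit event all answers, hence the auctions, coincide. -/
theorem winProb_run_le [IsProbabilityMeasure P] {D D' : Prior n m H} {B : Set (Query n m)}
    (hB : MeasurableSet B) (h : ∀ q ∉ B, D.answer q = D'.answer q) (i : Fin n) (j : Fin m)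
    (b : Fin n → Fin m → ℝ) :
    (M.run D).winProb i j b ≤ (M.run D').winProb i j b + P.real (M.hit B) := by
  have hint : ∀ D : Prior n m H,
      Integrable (fun ω => (M.auction ω fun q _ => D.answer q).winProb i j b) P := fun D =>
    integrable_finsetSum _ fun a _ => (M.integrable_prob D b a).mul_const _
  have hrun : ∀ D : Prior n m H, (M.run D).winProb i j b
      = ∫ ω, (M.auction ω fun q _ => D.answer q).winProb i j b ∂P := by
    intro D
    simp only [Auction.winProb, run]
    rw [integral_finsetSum _ fun a _ => (M.integrable_prob D b a).mul_const _]
    simp_rw [integral_mul_const]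
  have hE := measurableSet_hit (M := M) hB
  have hind : Integrable ((M.hit B).indicator (1 : Ω → ℝ)) P :=
    (integrable_const (1 : ℝ)).indicator hE
  rw [hrun, hrun, ← integral_indicator_one hE,
    ← integral_add (hint D') hind]
  refine integral_mono (hint D) ((hint D').add hind) fun ω => ?_
  dsimp only
  by_cases hω : ω ∈ M.hit B
  · rw [Set.indicator_of_mem hω]
    have h1 := (M.auction ω fun q _ => D.answer q).winProb_le_one i j b
    have h2 := (M.auction ω fun q _ => D'.answer q).winProb_nonneg i j b
    simp only [Pi.one_apply]
    linarith
  · have : (fun q (_ : q ∈ M.queries ω) => D.answer q) = fun q _ => D'.answer q := by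
      funext q hq
      exact h q (notMem_of_notMem_hit hω hq)
    rw [Set.indicator_of_notMem hω, this, add_zero]

end QueryMechanism

/-! ### Revenue of a DSIC auction on a gap prior. -/

section GapPrior

variable {L r : ℝ} {K k : ℕ}

theorem ladder_mem_Icc (hL : 1 ≤ L) (hr : 1 ≤ r) (hH : L * r ^ K ≤ H) {l : ℕ} (hl : l ≤ K) :
    L * r ^ l ∈ Set.Icc 1 H :=
  ⟨one_le_mul_of_one_le_of_one_le hL (one_le_pow₀ hr),
    (ladder_mono (zero_le_one.trans hL) hr hl).trans hH⟩

theorem gapPoint_mem_Icc (hL : 1 ≤ L) (hr : 1 ≤ r) (hH : L * r ^ K ≤ H) (hk : k < K) {l : ℕ}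
    (hl : l ≤ K) : gapPoint L r k l ∈ Set.Icc 1 H := by
  unfold gapPoint
  split_ifs
  · exact ladder_mem_Icc hL hr hH hk
  · exact ladder_mem_Icc hL hr hH hl

theorem ae_ladderLaw (hL : 1 ≤ L) (hr : 1 ≤ r) (hH : L * r ^ K ≤ H) :
    ∀ᵐ x ∂(ladderLaw L r K), x ∈ Set.Icc 1 H :=
  ae_discreteLaw fun _ hl => ladder_mem_Icc hL hr hH (Nat.lt_succ_iff.1 (Finset.mem_range.1 hl))

theorem ae_gapLaw (hL : 1 ≤ L) (hr : 1 ≤ r) (hH : L * r ^ K ≤ H) (hk : k < K) :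
    ∀ᵐ x ∂(gapLaw L r K k), x ∈ Set.Icc 1 H :=
  ae_discreteLaw fun _ hl =>
    gapPoint_mem_Icc hL hr hH hk (Nat.lt_succ_iff.1 (Finset.mem_range.1 hl))

theorem isProbabilityMeasure_ladderLaw (hr : 1 ≤ r) : IsProbabilityMeasure (ladderLaw L r K) :=
  isProbabilityMeasure_discreteLaw (ladderWeight_nonneg hr) (sum_ladderWeight r K)

theorem isProbabilityMeasure_gapLaw (hr : 1 ≤ r) : IsProbabilityMeasure (gapLaw L r K k) :=
  isProbabilityMeasure_discreteLaw (ladderWeight_nonneg hr) (sum_ladderWeight r K)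

theorem revenue_gapLaw_le {v : Fin n → Valuation m} (hv : ∀ i, IsSuccinctSubadditive (v i))
    {A : Auction n m} (hA : A.IsDSIC v H) (hH : 1 ≤ H) (hL : 1 ≤ L) (hr : 2 ≤ r)
    (hK : L * r ^ K ≤ H) (hk : k + 1 < K) (i : Fin n) (j : Fin m)
    [IsProbabilityMeasure (gapLaw L r K (k + 1))]
    (hμ : ∀ᵐ x ∂(gapLaw L r K (k + 1)), x ∈ Set.Icc 1 H) :
    Integrable (fun b => ∑ i, A.pay b i) (singlePrior hH i j (gapLaw L r K (k + 1)) hμ).joint ∧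
    A.revenue (singlePrior hH i j (gapLaw L r K (k + 1)) hμ)
      ≤ L + L * (r - 1) * (A.winProb i j (profile i j (L * r ^ (k + 2)))
        - A.winProb i j (profile i j (L * r ^ k))) + 2 * m + n * m := by
  have hr1 : 1 ≤ r := by linarith
  have hmem : ∀ l ≤ K, gapPoint L r (k + 1) l ∈ Set.Icc 1 H := fun l hl =>
    gapPoint_mem_Icc hL hr1 hK hk hl
  have hw := ladderWeight_nonneg (K := K) hr1
  have : IsProbabilityMeasure (discreteLaw (ladderWeight r K) (gapPoint L r (k + 1)) (K + 1)) :=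
    isProbabilityMeasure_discreteLaw hw (sum_ladderWeight r K)
  obtain ⟨hint, hrev⟩ := Auction.revenue_singlePrior_discreteLaw (j := j) (i := i) hH hμ hw A
  refine ⟨hint, hrev.le.trans ?_⟩
  have hmain := sum_ladderWeight_mul_le (L := L) (r := r) (K := K) (k := k) (e := m)
    (p := fun l => A.pay (profile i j (gapPoint L r (k + 1) l)) i)
    (q := fun l => A.winProb i j (profile i j (gapPoint L r (k + 1) l)))
    (by linarith) hr (by positivity) hk (fun l => A.winProb_le_one i j _)
    (Auction.pay_le_of_rational hA hv hH (hmem 0 (Nat.zero_le _)))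
    (fun l hl => Auction.pay_le_of_truthful hA hv hH (hmem (l + 1) hl) (hmem l hl.le))
  -- With the gap at `k + 1`, a lower neighbour always exists and the critical jump spans two rungs,
  -- from `k` to `k + 2`.
  have e1 : gapPoint L r (k + 1) (k + 1) = L * r ^ (k + 2) := by simp [gapPoint]
  have e2 : gapPoint L r (k + 1) k = L * r ^ k := by simp [gapPoint]
  simp only [e1, e2] at hmain
  have hsum : ∑ l ∈ Finset.range (K + 1),
      ladderWeight r K l * ∑ i', A.pay (profile i j (gapPoint L r (k + 1) l)) i'
      ≤ ∑ l ∈ Finset.range (K + 1),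
        (ladderWeight r K l * A.pay (profile i j (gapPoint L r (k + 1) l)) i
          + ladderWeight r K l * (n * m)) := by
    refine Finset.sum_le_sum fun l hl => ?_
    rw [← mul_add]
    exact mul_le_mul_of_nonneg_left (Auction.sum_pay_le hA hv hH
      (hmem l (Nat.lt_succ_iff.1 (Finset.mem_range.1 hl)))) (hw l)
  rw [Finset.sum_add_distrib, ← Finset.sum_mul, sum_ladderWeight, one_mul] at hsum
  linarith

end GapPrior

/-! ### Averaging over the gaps. -/

/-- The queries about player `i` and item `j` that distinguish the `k`-th gap law. -/
def pairQueries (L r : ℝ) (i : Fin n) (j : Fin m) (k : ℕ) : Set (Query n m) :=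
  {q | q.1 = i ∧ q.2.1 = j ∧ q.2.2 ∈ gapQueries L r k}

theorem measurableSet_pairQueries (L r : ℝ) (i : Fin n) (j : Fin m) (k : ℕ) :
    MeasurableSet (pairQueries L r i j k) :=
  (measurable_fst (measurableSet_singleton i)).inter
    ((measurable_fst.comp measurable_snd (measurableSet_singleton j)).inter
      (measurable_snd.comp measurable_snd (measurableSet_gapQueries L r k)))

/-- Telescoping in steps of two leaves two top and two bottom terms; monotonicity of `g` is not
needed. -/
theorem sum_range_sub_two_le {g : ℕ → ℝ} (h0 : ∀ l, 0 ≤ g l) (h1 : ∀ l, g l ≤ 1) (N : ℕ) :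
    ∑ k ∈ Finset.range N, (g (k + 2) - g k) ≤ 2 := by
  have : ∑ k ∈ Finset.range N, (g (k + 2) - g k) = g (N + 1) + g N - g 1 - g 0 := by
    induction N with
    | zero => simp
    | succ N ih => rw [Finset.sum_range_succ, ih]; ring
  rw [this]
  linarith [h0 0, h0 1, h1 N, h1 (N + 1)]

/-- If the expected number of queries is small compared with the number of gaps, then some gap
law for some pair is rarely detected and rarely targeted. -/
theorem exists_rare_gap {Ω : Type*} [MeasurableSpace Ω] {P : Measure Ω} [IsProbabilityMeasure P]
    {M : QueryMechanism Ω P n m H} {L r Q : ℝ} {N : ℕ} (hL : 0 ≤ L) (hr : 1 < r)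
    (hM : M.queryComplexity ≤ ENNReal.ofReal Q) (hQ0 : 0 ≤ Q)
    (hQ : (r - 1) * (2 * (n * m) + 2 * Q) < n * m * N)
    (g : Fin n → Fin m → ℕ → ℝ) (h0 : ∀ i j l, 0 ≤ g i j l) (h1 : ∀ i j l, g i j l ≤ 1) :
    ∃ i j, ∃ k < N, (r - 1) * (g i j (k + 2) - g i j k
      + 2 * P.real (M.hit (pairQueries L r i j (k + 1)))) < 1 := by
  classical
  set s : Finset (Fin n × Fin m × ℕ) := Finset.univ ×ˢ Finset.univ ×ˢ Finset.range N with hs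
  have hhit : ∑ x ∈ s, P.real (M.hit (pairQueries L r x.1 x.2.1 (x.2.2 + 1))) ≤ Q := by
    refine (QueryMechanism.sum_real_hit_le s
      (fun x => pairQueries L r x.1 x.2.1 (x.2.2 + 1))
      (fun x => measurableSet_pairQueries L r _ _ _) ?_
      (hM.trans_lt ENNReal.ofReal_lt_top).ne).trans (ENNReal.toReal_le_of_le_ofReal hQ0 hM)
    rintro ⟨i, j, k⟩ ⟨i', j', k'⟩ q ⟨rfl, rfl, h⟩ ⟨rfl, rfl, h'⟩
    have := pairwise_disjoint_gapQueries hL hr.le h h'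
    simp only [Prod.mk.injEq, true_and]
    simpa using this
  have hg : ∑ x ∈ s, (g x.1 x.2.1 (x.2.2 + 2) - g x.1 x.2.1 x.2.2) ≤ n * m * 2 := by
    rw [hs, Finset.sum_product]
    simp_rw [Finset.sum_product]
    calc _ ≤ ∑ _i : Fin n, ∑ _j : Fin m, (2 : ℝ) := Finset.sum_le_sum fun i _ =>
          Finset.sum_le_sum fun j _ => sum_range_sub_two_le (h0 i j) (h1 i j) N
      _ = n * m * 2 := by simp [mul_assoc]
  have hlt : ∑ x ∈ s, (r - 1) * (g x.1 x.2.1 (x.2.2 + 2) - g x.1 x.2.1 x.2.2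
      + 2 * P.real (M.hit (pairQueries L r x.1 x.2.1 (x.2.2 + 1)))) < ∑ x ∈ s, (1 : ℝ) := by
    rw [← Finset.mul_sum, Finset.sum_add_distrib, ← Finset.mul_sum]
    have hcard : ∑ x ∈ s, (1 : ℝ) = n * m * N := by simp [hs, mul_assoc]
    rw [hcard]
    refine lt_of_le_of_lt (mul_le_mul_of_nonneg_left ?_ (by linarith)) hQ
    linarith
  obtain ⟨⟨i, j, k⟩, hx, hlt⟩ := Finset.exists_lt_of_sum_lt hlt
  exact ⟨i, j, k, by simpa [hs] using hx, hlt⟩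

/-- A mechanism with few queries, in terms of the number `K` of points of the ladder. -/
theorem exists_revenue_lt {c L Q : ℝ} {K : ℕ} (hc : 1 < c) (hL : 3 * (n * m) + 1 ≤ L)
    (hnm : 1 ≤ n) (hK : L * (4 * c) ^ K ≤ H)
    {v : Fin n → Valuation m} (hv : ∀ i, IsSuccinctSubadditive (v i))
    {Ω : Type*} [MeasurableSpace Ω] {P : Measure Ω} [IsProbabilityMeasure P]
    {M : QueryMechanism Ω P n m H} (hDSIC : M.IsDSIC v)
    (hM : M.queryComplexity ≤ ENNReal.ofReal Q) (hQ0 : 0 ≤ Q)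
    (hQ : (4 * c - 1) * (2 * (n * m) + 2 * Q) < n * m * ((K - 1 : ℕ) : ℝ)) :
    ∃ D : Prior n m H, Integrable (fun b => ∑ i, (M.run D).pay b i) D.joint ∧
      ((M.run D).revenue D : EReal) < OPT v D / (c : EReal) := by
  set r := 4 * c with hr
  have hr1 : 1 ≤ r := by linarith
  have hnm0 : (0 : ℝ) ≤ n * m := by positivity
  have hL1 : 1 ≤ L := by linarith
  have hH : 1 ≤ H := by
    have := ladder_mem_Icc hL1 hr1 hK (Nat.zero_le K)
    exact this.1.trans this.2
  have := fun k => isProbabilityMeasure_gapLaw (L := L) (K := K) (k := k) hr1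
  have := isProbabilityMeasure_ladderLaw (L := L) (K := K) hr1
  -- The jumps are measured on the gap-free prior: its auction does not depend on `k`, so they
  -- telescope.
  let D₀ := fun (i : Fin n) (j : Fin m) =>
    singlePrior hH i j (ladderLaw L r K) (ae_ladderLaw hL1 hr1 hK)
  obtain ⟨i, j, k, hk, hlt⟩ := exists_rare_gap (L := L) (by linarith) (by linarith) hM hQ0 hQ
    (fun i j l => (M.run (D₀ i j)).winProb i j (profile i j (L * r ^ l)))
    (fun i j l => Auction.winProb_nonneg _ i j _) (fun i j l => Auction.winProb_le_one _ i j _)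
  have hk' : k + 1 < K := by omega
  set D := singlePrior hH i j (gapLaw L r K (k + 1)) (ae_gapLaw hL1 hr1 hK hk') with hD
  obtain ⟨hint, hrev⟩ := revenue_gapLaw_le hv (hDSIC D) hH hL1 (by linarith) hK hk' i j
    (ae_gapLaw hL1 hr1 hK hk')
  refine ⟨D, hint, ?_⟩
  have hans : ∀ q ∉ pairQueries L r i j (k + 1), D.answer q = (D₀ i j).answer q := by
    intro q hq
    refine answer_singlePrior_of_ne _ _ _ _ _ _ _ fun h => oracle_gapLaw (by linarith) hr1 hk' ?_
    exact fun h' => hq ⟨h.1, h.2, h'⟩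
  have hmeas := measurableSet_pairQueries L r i j (k + 1)
  -- Each end of the jump costs one detection probability, hence the factor `2` in
  -- `exists_rare_gap`.
  have w1 := QueryMechanism.winProb_run_le (M := M) hmeas hans i j (profile i j (L * r ^ (k + 2)))
  have w2 := QueryMechanism.winProb_run_le (M := M) hmeas (fun q hq => (hans q hq).symm) i j
    (profile i j (L * r ^ k))
  have hm : (m : ℝ) ≤ n * m := by
    exact_mod_cast Nat.le_mul_of_pos_left m hnm
  -- The bound is `L + L + 2 * m + n * m ≤ 2 * L + 3 * (n * m)`, below `4 * L` by the choice of `L`.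
  have hrevlt : (M.run D).revenue D < 4 * L := by
    have hdiff : (r - 1) * ((M.run D).winProb i j (profile i j (L * r ^ (k + 2)))
        - (M.run D).winProb i j (profile i j (L * r ^ k))) ≤ 1 :=
      (mul_le_mul_of_nonneg_left (by linarith) (by linarith)).trans hlt.le
    have := mul_le_mul_of_nonneg_left hdiff (show 0 ≤ L by linarith)
    linarith
  have hopt := le_OPT hv i j (L * r ^ (k + 2)) D
  have hIoc : L * r ^ (k + 2) ∈ Set.Ioc (L * r ^ (k + 1)) (L * r ^ (k + 1 + 1)) := by
    refine ⟨?_, le_rfl⟩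
    exact mul_lt_mul_of_pos_left (pow_lt_pow_right₀ (by linarith) (by omega)) (by linarith)
  rw [hD, singlePrior_law_self, gapLaw_Ici (by linarith) hr1 hk' hIoc, ← hD] at hopt
  -- The price just above the gap still sells with the tail probability of the rung below it, and so
  -- earns `L * r`.
  have hval : L * r ^ (k + 2) * r⁻¹ ^ (k + 1) = 4 * L * c := by
    have : r ^ (k + 1) * r⁻¹ ^ (k + 1) = 1 := by
      rw [← mul_pow, mul_inv_cancel₀ (by linarith), one_pow]
    rw [pow_succ r (k + 1)]
    linear_combination (L * r) * this + L * hr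
  rw [hval] at hopt
  calc ((M.run D).revenue D : EReal) < ((4 * L : ℝ) : EReal) := EReal.coe_lt_coe_iff.2 hrevlt
    _ = ((4 * L * c : ℝ) : EReal) / (c : EReal) := by
      rw [← EReal.coe_div, mul_div_cancel_right₀ _ (by linarith)]
    _ ≤ OPT v D / (c : EReal) :=
      EReal.div_le_div_right_of_nonneg (by exact_mod_cast (by linarith : (0 : ℝ) ≤ c)) hopt

end BayesianQuery

/-! ### Choice of the constants. -/

theorem mainTheorem1 (c : ℝ) (hc : 1 < c) :
    ∃ C : ℝ, 0 < C ∧ ∀ n m : ℕ, 1 ≤ n → 1 ≤ m →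
      ∃ H₀ : ℝ, ∀ H : ℝ, H₀ ≤ H →
        ∀ v : Fin n → BayesianQuery.Valuation m,
          (∀ i, BayesianQuery.IsSuccinctSubadditive (v i)) →
        ∀ (Ω : Type*) [MeasurableSpace Ω] (P : MeasureTheory.Measure Ω)
          [MeasureTheory.IsProbabilityMeasure P]
          (M : BayesianQuery.QueryMechanism Ω P n m H),
          M.IsDSIC v →
          M.queryComplexity < ENNReal.ofReal (C * n * m * Real.logb c H) →
          ∃ D : BayesianQuery.Prior n m H,
            MeasureTheory.Integrable (fun b => ∑ i, (M.run D).pay b i) D.joint ∧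
            ((M.run D).revenue D : EReal) < BayesianQuery.OPT v D / (c : EReal) := by
  have hlogc : 0 < Real.log c := Real.log_pos hc
  set r := 4 * c with hr
  have hr1 : 1 < r := by linarith
  have hlogr : 0 < Real.log r := Real.log_pos hr1
  -- The query budget becomes `Q = n * m * T / (4 * (r - 1))` with `T = logb r H`, so the detection
  -- term `2 * (r - 1) * Q` is `n * m * T / 2`, about half the number of gaps.
  refine ⟨Real.log c / (4 * (r - 1) * Real.log r),
    div_pos hlogc (mul_pos (by linarith) hlogr), fun n m hn hm => ?_⟩
  set L : ℝ := 3 * (n * m) + 1 with hL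
  have hnm : (1 : ℝ) ≤ n * m := by exact_mod_cast Nat.mul_pos hn hm
  have hL0 : 0 < L := by linarith
  have hlogL : 0 ≤ Real.logb r L := Real.logb_nonneg hr1 (by linarith)
  -- The averaging needs `2 * (r - 1) + T / 2 < K - 1`, where `K > T - logb r L - 1`; `T ≥ 4 * r + 2
  -- * logb r L` is enough, and the `4` is slack.
  refine ⟨r ^ (4 * r + 2 * Real.logb r L + 4), fun H hH v hv Ω _ P _ M hD hM => ?_⟩
  have hHpos : 0 < H := (Real.rpow_pos_of_pos (by linarith) _).trans_le hH
  have hT : 4 * r + 2 * Real.logb r L + 4 ≤ Real.logb r H :=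
    (Real.le_logb_iff_rpow_le hr1 hHpos).2 hH
  set T := Real.logb r H with hTdef
  have hC : Real.log c / (4 * (r - 1) * Real.log r) * n * m * Real.logb c H
      = n * m * T / (4 * (r - 1)) := by
    have : r - 1 ≠ 0 := by linarith
    rw [hTdef, Real.logb, Real.logb]
    field_simp
  rw [hC] at hM
  have hquot : Real.logb r (H / L) = T - Real.logb r L := Real.logb_div hHpos.ne' hL0.ne'
  set K := ⌊Real.logb r (H / L)⌋₊ with hKdef
  have hKlow : T - Real.logb r L < K + 1 := hquot ▸ Nat.lt_floor_add_one _
  have hKle : (K : ℝ) ≤ Real.logb r (H / L) := Nat.floor_le (by rw [hquot]; linarith)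
  have hK : L * r ^ K ≤ H := by
    have := (Real.le_logb_iff_rpow_le hr1 (div_pos hHpos hL0)).1 hKle
    rw [Real.rpow_natCast, le_div_iff₀ hL0] at this
    linarith
  have hK1 : 1 ≤ K := by
    have : (0 : ℝ) < K := by linarith
    exact_mod_cast this
  refine BayesianQuery.exists_revenue_lt hc le_rfl hn hK hv hD hM.le ?_ ?_
  · exact div_nonneg (mul_nonneg (by linarith) (by linarith)) (by linarith)
  · have h1 : (r - 1) * (2 * (n * m) + 2 * (n * m * T / (4 * (r - 1))))
        = n * m * (2 * (r - 1) + T / 2) := by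
      have : r - 1 ≠ 0 := by linarith
      field_simp
      ring
    rw [h1, Nat.cast_sub hK1, Nat.cast_one]
    exact mul_lt_mul_of_pos_left (by linarith) (by linarith)
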